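/- **Setting.** Let $(X,d)$ be a metric space, let $\mu$ be a Borel measure on $X$ (a measure on a $\sigma$-algebra containing the Borel sets; "measurable" refers to this $\sigma$-algebra), and let $p\in[1,\infty)$. Put $|\infty-\infty|=|(-\infty)-(-\infty)|=\infty$. A *test curve* is a map $\gamma:[0,1]\to X$ of bounded variation that is right-continuous on $[0,1)$, left-continuous at $1$, and has a left limit $\gamma(t^-)$ at every $t\in(0,1)$. It is *nontrivial* if its variation $V(\gamma)$ is positive. Its *reversal* is $\overleftarrow{\gamma}(t)=\gamma((1-t)^-)$, where $\gamma(0^-)=\gamma(0)$; this is again a test curve. Let $V_\gamma(t)=V(\gamma|_{[0,t]})$ and let $\mu_\gamma$ be the Borel measure on $[0,1]$ with $\mu_\gamma((r,t])=V_\gamma(t)-V_\gamma(r)$ for $r<t$ and $\mu_\gamma(\{0\})=0$. For a Borel function $g:X\to[0,\infty]$ put $$\int_\gamma g=\int_{[0,1]}g\circ\gamma\,d\mu_\gamma,\qquad \int^S_\gamma g=\frac12\Big(\int_\gamma g+\int_{\overleftarrow{\gamma}}g\Big).$$ The *$p$-modulus* of a family $\Gamma$ of nontrivial test curves is $\inf_\rho\int_X\rho^p\,d\mu$,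 the infimum being over all Borel $\rho:X\to[0,\infty]$ with $\int^S_\gamma\rho\ge1$ for all $\gamma\in\Gamma$. A Borel function $g:X\to[0,\infty]$ is an *upper S-gradient* of $f:X\to[-\infty,\infty]$ if $|f(\gamma(1))-f(\gamma(0))|\le\int^S_\gamma g$ for every nontrivial test curve $\gamma$, and a *$p$-weak upper S-gradient* of $f$ if the family of nontrivial test curves for which this inequality fails has $p$-modulus $0$. A measurable $g:X\to[0,\infty]$ is a *Hajłasz gradient* of a measurable, $\mu$-a.e. finite $f:X\to[-\infty,\infty]$ if there is a measurable set $E$ with $\mu(E)=0$ and $|f(y)-f(x)|\le(g(x)+g(y))\,d(x,y)$ for all $x,y\in X\setminus E$. The measure $\mu$ is *Borel regular* if every measurable set is contained in a Borel set of the same measure. **Theorem.** Let $f:X\to[-\infty,\infty]$ and $g:X\to[0,\infty]$ be measurable and finite $\mu$-almost everywhere. (a) If $g$ is a $p$-weak upper S-gradient of $f$, then $g/2$ is a Hajłasz gradient of $f$. (b) If $\mu$ is $\sigma$-finite and Borel regular and $g$ is a Hajłasz gradient of $f$, then there exist Borel functions $\tilde f:X\to\mathbb R$ and $\tilde g:X\to[0,\infty]$,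 equal $\mu$-a.e. to $f$ and $g$ respectively, such that $76\,\tilde g$ is an upper S-gradient of $\tilde f$, that is, $|\tilde f(\gamma(1))-\tilde f(\gamma(0))|\le\int^S_\gamma 76\,\tilde g$ for every nontrivial test curve $\gamma$. -/

import Mathlib

open Set Filter Topology MeasureTheory
open scoped ENNReal

/-!
### Test curves

A curve `[a, b] → X` is represented by a function `γ : ℝ → X` of which only the restriction to
`[a, b]` matters: no definition below depends on the values of `γ` outside `[a, b]`.
The variation of `γ` on `[a, b]` is Mathlib's `eVariationOn γ (Icc a b)`.
-/

/-- `γ` is a test curve on the nondegenerate interval `[a, b]`: it has bounded variation, is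
right-continuous on `[a, b)`, left-continuous at `b`, and has left limits at all points of
`(a, b)`. -/
structure IsTestCurve {X : Type*} [MetricSpace X] (γ : ℝ → X) (a b : ℝ) : Prop where
  lt : a < b
  boundedVariation : BoundedVariationOn γ (Icc a b)
  rightContinuous : ∀ t ∈ Ico a b, ContinuousWithinAt γ (Ici t) t
  leftContinuous : ContinuousWithinAt γ (Iic b) b
  leftLimits : ∀ t ∈ Ioo a b, ∃ x : X, Tendsto γ (𝓝[<] t) (𝓝 x)

/-- The reversal `t ↦ γ((a + b - t)⁻)` on `[a, b]`, with the convention `γ(a⁻) = γ(a)`. -/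
noncomputable def reversal {X : Type*} [MetricSpace X] (γ : ℝ → X) (a b : ℝ) : ℝ → X :=
  fun t => if t < b then Function.leftLim γ (a + b - t) else γ a

/-- The variation function `t ↦ V(γ|_[a, t])`, extended to `ℝ` by `0` to the left of `a` and by
its value at `b` to the right of `b`. -/
noncomputable def variationFunction {X : Type*} [MetricSpace X] (γ : ℝ → X) (a b : ℝ) : ℝ → ℝ :=
  fun t => (eVariationOn γ (Icc a b ∩ Iic t)).toReal

/-- The constant extension to `ℝ` of `γ` restricted to `[a, b]` (auxiliary). -/
def clampCurve {X : Type*} (γ : ℝ → X) (a b : ℝ) : ℝ → X := fun t => γ (max a (min b t))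

theorem monotone_clamp (a b : ℝ) : Monotone (fun t : ℝ => max a (min b t)) :=
  fun _ _ h => max_le_max le_rfl (min_le_min le_rfl h)

theorem clampCurve_of_mem {X : Type*} (γ : ℝ → X) {a b t : ℝ} (ht : t ∈ Icc a b) :
    clampCurve γ a b t = γ t := by
  simp [clampCurve, ht.1, ht.2]

theorem tendsto_leftLim_nhdsGT {X : Type*} [MetricSpace X] {f : ℝ → X} {w : ℝ} {y : X}
    (h : Tendsto f (𝓝[>] w) (𝓝 y)) : Tendsto (Function.leftLim f) (𝓝[>] w) (𝓝 y) := by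
  apply (closed_nhds_basis y).tendsto_right_iff.2
  rintro s ⟨s_mem, s_closed⟩
  obtain ⟨u, hwu, hu⟩ : ∃ u, w < u ∧ Ioo w u ⊆ {x | f x ∈ s} := by
    have := (closed_nhds_basis y).tendsto_right_iff.1 h s ⟨s_mem, s_closed⟩
    simpa using mem_nhdsGT_iff_exists_Ioo_subset.1 this
  filter_upwards [Ioo_mem_nhdsGT hwu] with c hc
  by_cases! h''c : ¬ ∃ y, Tendsto f (𝓝[<] c) (𝓝 y)
  · simpa [leftLim_eq_of_not_tendsto _ h''c] using hu hc
  apply s_closed.mem_of_tendsto (tendsto_leftLim_of_tendsto h''c)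
  filter_upwards [Ioo_mem_nhdsLT_of_mem ⟨hc.1, hc.2.le⟩] with d hd using hu hd

namespace IsTestCurve

variable {X : Type*} [MetricSpace X] {γ : ℝ → X} {a b : ℝ}

theorem clamp_boundedVariation (h : IsTestCurve γ a b) :
    BoundedVariationOn (clampCurve γ a b) univ := by
  have := eVariationOn.comp_le_of_monotoneOn γ (s := Icc a b) (t := univ)
    (fun t : ℝ => max a (min b t)) ((monotone_clamp a b).monotoneOn _)
    (fun t _ => ⟨le_max_left _ _, max_le h.lt.le (min_le_left _ _)⟩)
  exact (this.trans_lt h.boundedVariation.lt_top).ne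

theorem clamp_rightContinuous (h : IsTestCurve γ a b) (t : ℝ) :
    ContinuousWithinAt (clampCurve γ a b) (Ici t) t := by
  have hc : ContinuousWithinAt (fun t : ℝ => max a (min b t)) (Ici t) t :=
    Continuous.continuousWithinAt (by fun_prop)
  rcases lt_or_ge t b with htb | htb
  · have ht : max a (min b t) ∈ Ico a b := ⟨le_max_left _ _, max_lt h.lt (min_lt_of_right_lt htb)⟩
    exact ContinuousWithinAt.comp (g := γ) (f := fun t : ℝ => max a (min b t))
      (t := Ici (max a (min b t))) (h.rightContinuous _ ht) hc fun s hs => monotone_clamp a b hs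
  · refine (continuousWithinAt_const (b := γ b)).congr (fun s hs => ?_) ?_
    · simp [clampCurve, h.lt.le, htb.trans hs]
    · simp [clampCurve, h.lt.le, htb]

theorem tendsto_left (h : IsTestCurve γ a b) {t : ℝ} (ht : t ∈ Ioc a b) :
    Tendsto γ (𝓝[<] t) (𝓝 (Function.leftLim γ t)) := by
  rcases ht.2.lt_or_eq with htb | rfl
  · exact tendsto_leftLim_of_tendsto (h.leftLimits t ⟨ht.1, htb⟩)
  · exact tendsto_leftLim_of_tendsto
      ⟨γ t, h.leftContinuous.tendsto.mono_left (nhdsWithin_mono _ Iio_subset_Iic_self)⟩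

theorem clamp_tendsto_left (h : IsTestCurve γ a b) {t : ℝ} (ht : t ∈ Ioc a b) :
    Tendsto (clampCurve γ a b) (𝓝[<] t) (𝓝 (Function.leftLim γ t)) := by
  refine (h.tendsto_left ht).congr' ?_
  filter_upwards [Ioo_mem_nhdsLT ht.1] with s hs
  exact (clampCurve_of_mem γ ⟨hs.1.le, hs.2.le.trans ht.2⟩).symm

theorem leftLim_clamp (h : IsTestCurve γ a b) {t : ℝ} (ht : t ∈ Ioc a b) :
    Function.leftLim (clampCurve γ a b) t = Function.leftLim γ t :=
  leftLim_eq_of_tendsto (h.clamp_tendsto_left ht)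

theorem leftLim_clamp_left (h : IsTestCurve γ a b) :
    Function.leftLim (clampCurve γ a b) a = γ a := by
  apply leftLim_eq_of_tendsto
  refine tendsto_const_nhds.congr' ?_
  filter_upwards [self_mem_nhdsWithin] with s hs
  have hs' : s < a := hs
  simp [clampCurve, (hs'.trans h.lt).le, hs'.le]

theorem reversal_eq (h : IsTestCurve γ a b) {t : ℝ} (ht : t ∈ Icc a b) :
    reversal γ a b t = Function.leftLim (clampCurve γ a b) (a + b - t) := by
  unfold reversal
  split_ifs with htb
  · exact (h.leftLim_clamp ⟨by linarith, by linarith [ht.1]⟩).symm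
  · obtain rfl : t = b := le_antisymm ht.2 (not_lt.1 htb)
    rw [add_sub_cancel_right, h.leftLim_clamp_left]

theorem reversal_tendsto_left (h : IsTestCurve γ a b) {t : ℝ} (ht : t ∈ Ioc a b) :
    Tendsto (reversal γ a b) (𝓝[<] t) (𝓝 (γ (a + b - t))) := by
  have hw : a + b - t ∈ Icc a b := ⟨by linarith [ht.2], by linarith [ht.1]⟩
  have h1 : Tendsto (clampCurve γ a b) (𝓝[>] (a + b - t)) (𝓝 (γ (a + b - t))) := by
    rw [← clampCurve_of_mem γ hw]
    exact (h.clamp_rightContinuous _).tendsto.mono_left (nhdsWithin_mono _ Ioi_subset_Ici_self)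
  have h2 : Tendsto (fun s : ℝ => a + b - s) (𝓝[<] t) (𝓝[>] (a + b - t)) := by
    refine tendsto_nhdsWithin_of_tendsto_nhds_of_eventually_within _
      ((Continuous.tendsto (by fun_prop) t).mono_left nhdsWithin_le_nhds) ?_
    filter_upwards [self_mem_nhdsWithin] with s hs
    have hs' : s < t := hs
    exact sub_lt_sub_left hs' _
  refine ((tendsto_leftLim_nhdsGT h1).comp h2).congr' ?_
  filter_upwards [Ioo_mem_nhdsLT ht.1] with s hs
  exact (h.reversal_eq ⟨hs.1.le, hs.2.le.trans ht.2⟩).symm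

/-- The reversal of a test curve is a test curve. -/
theorem reverse (h : IsTestCurve γ a b) : IsTestCurve (reversal γ a b) a b where
  lt := h.lt
  boundedVariation := by
    have h1 : EqOn (reversal γ a b)
        (Function.leftLim (clampCurve γ a b) ∘ fun t => a + b - t) (Icc a b) :=
      fun t ht => h.reversal_eq ht
    have h2 := eVariationOn.comp_le_of_antitoneOn (Function.leftLim (clampCurve γ a b))
      (s := univ) (t := Icc a b) (fun t => a + b - t)
      (fun x _ y _ hxy => sub_le_sub_left hxy _) (fun _ _ => mem_univ _)
    unfold BoundedVariationOn
    rw [eVariationOn.congr h1]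
    exact (h2.trans_lt h.clamp_boundedVariation.leftLim.lt_top).ne
  rightContinuous := by
    intro t ht
    have hw : a + b - t ∈ Ioc a b := ⟨by linarith [ht.2], by linarith [ht.1]⟩
    have h1 : ContinuousWithinAt (Function.leftLim (clampCurve γ a b)) (Iic (a + b - t))
        (a + b - t) := by
      apply continuousWithinAt_leftLim_Iic
      rw [h.leftLim_clamp hw]
      exact h.clamp_tendsto_left hw
    have h2 : ContinuousWithinAt (Function.leftLim (clampCurve γ a b) ∘ fun t => a + b - t)
        (Ici t) t :=
      ContinuousWithinAt.comp (t := Iic (a + b - t)) h1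
        (Continuous.continuousWithinAt (by fun_prop)) fun s hs => sub_le_sub_left (mem_Ici.1 hs) _
    refine h2.congr_of_eventuallyEq ?_ (h.reversal_eq ⟨ht.1, ht.2.le⟩)
    filter_upwards [Ico_mem_nhdsGE ht.2] with s hs
    exact h.reversal_eq ⟨ht.1.trans hs.1, hs.2.le⟩
  leftContinuous := by
    have h1 := h.reversal_tendsto_left (t := b) ⟨h.lt, le_rfl⟩
    have h2 : reversal γ a b b = γ (a + b - b) := by simp [reversal]
    rw [← h2] at h1
    exact continuousWithinAt_Iio_iff_Iic.1 h1
  leftLimits := fun t ht => ⟨_, h.reversal_tendsto_left ⟨ht.1, ht.2.le⟩⟩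

theorem variationFunction_eq (h : IsTestCurve γ a b) (t : ℝ) :
    variationFunction γ a b t = variationOnFromTo (clampCurve γ a b) univ a t := by
  have hcomp : ∀ u v : ℝ, eVariationOn (clampCurve γ a b) (univ ∩ Icc u v) =
      eVariationOn γ ((fun t : ℝ => max a (min b t)) '' Icc u v) := fun u v => by
    rw [univ_inter]
    exact eVariationOn.comp_eq_of_monotoneOn γ _ ((monotone_clamp a b).monotoneOn _)
  have hab := h.lt
  unfold variationFunction variationOnFromTo
  split_ifs with hat
  · rw [hcomp]
    congr 2
    ext s
    simp only [mem_inter_iff, mem_Icc, mem_Iic, mem_image]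
    constructor
    · rintro ⟨⟨h1, h2⟩, h3⟩
      exact ⟨s, ⟨h1, h3⟩, by simp [h1, h2]⟩
    · rintro ⟨x, ⟨h1, h2⟩, rfl⟩
      exact ⟨⟨le_max_left _ _, max_le hab.le (min_le_left _ _)⟩,
        max_le hat ((min_le_right _ _).trans h2)⟩
  · rw [hcomp, eVariationOn.subsingleton _ (s := Icc a b ∩ Iic t),
      eVariationOn.subsingleton]
    · simp
    · rintro _ ⟨x, hx, rfl⟩ _ ⟨y, hy, rfl⟩
      simp [hx.2, hy.2]
    · rintro x ⟨hx, hx'⟩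
      exact absurd (hx.1.trans hx') hat

/-- The variation function of a test curve is monotone and right-continuous. -/
noncomputable def stieltjes (h : IsTestCurve γ a b) : StieltjesFunction ℝ where
  toFun := variationFunction γ a b
  mono' := by
    intro s t hst
    refine ENNReal.toReal_mono
      ((eVariationOn.mono γ inter_subset_left).trans_lt h.boundedVariation.lt_top).ne
      (eVariationOn.mono γ (inter_subset_inter_right _ (Iic_subset_Iic.2 hst)))
  right_continuous' := by
    intro t
    rw [show variationFunction γ a b = variationOnFromTo (clampCurve γ a b) univ a from
      funext h.variationFunction_eq]
    exact h.clamp_boundedVariation.continuousWithinAt_variationOnFromTo_Ici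
      (h.clamp_rightContinuous t)

end IsTestCurve

/-- The Lebesgue–Stieltjes integral `∫_γ f = ∫_[a,b] f ∘ γ dμ_γ`, where
`μ_γ((r, t]) = V_γ(t) - V_γ(r)` and `μ_γ({a}) = 0`. -/
noncomputable def testCurveIntegral {X : Type*} [MetricSpace X] {γ : ℝ → X} {a b : ℝ}
    (h : IsTestCurve γ a b) (f : X → ℝ≥0∞) : ℝ≥0∞ :=
  ∫⁻ t in Icc a b, f (γ t) ∂h.stieltjes.measure

/-- The symmetrized integral `∫^S_γ f`: the average of the integrals along `γ` and its
reversal. -/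
noncomputable def symTestCurveIntegral {X : Type*} [MetricSpace X] {γ : ℝ → X} {a b : ℝ}
    (h : IsTestCurve γ a b) (f : X → ℝ≥0∞) : ℝ≥0∞ :=
  (testCurveIntegral h f + testCurveIntegral h.reverse f) / 2

/-- The nontrivial test curves `[0, 1] → X`, i.e. those of positive variation. -/
structure NontrivialTestCurve (X : Type*) [MetricSpace X] where
  toFun : ℝ → X
  isTestCurve : IsTestCurve toFun 0 1
  variation_pos : 0 < eVariationOn toFun (Icc 0 1)

/-- `∫^S_γ f` for a nontrivial test curve. -/
noncomputable def NontrivialTestCurve.symIntegral {X : Type*} [MetricSpace X]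
    (γ : NontrivialTestCurve X) (f : X → ℝ≥0∞) : ℝ≥0∞ :=
  symTestCurveIntegral γ.isTestCurve f

/-!
### Modulus and upper S-gradients

The σ-algebra on `X` may be larger than the Borel one; `Measurable[borel X]` means "Borel".
-/

/-- The `p`-modulus of a family of nontrivial test curves. -/
noncomputable def pModulus {X : Type*} [MetricSpace X] [MeasurableSpace X] (μ : Measure X) (p : ℝ)
    (Γ : Set (NontrivialTestCurve X)) : ℝ≥0∞ :=
  ⨅ (ρ : X → ℝ≥0∞) (_ : Measurable[borel X] ρ ∧ ∀ γ ∈ Γ, 1 ≤ γ.symIntegral ρ),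
    ∫⁻ x, ρ x ^ p ∂μ

/-- `|s - t|` for extended reals, with the convention `|∞ - ∞| = |(-∞) - (-∞)| = ∞`. -/
noncomputable def extDist (s t : EReal) : ℝ≥0∞ := (s - t).abs

theorem extDist_top_top : extDist ⊤ ⊤ = ∞ := by simp [extDist]

theorem extDist_bot_bot : extDist ⊥ ⊥ = ∞ := by simp [extDist]

theorem extDist_coe (s t : ℝ) : extDist s t = ENNReal.ofReal |s - t| := by
  rw [extDist, ← EReal.coe_sub, EReal.abs_def]

/-- The upper gradient inequality `|f(γ(1)) - f(γ(0))| ≤ ∫^S_γ g`. -/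
def UpperInequality {X : Type*} [MetricSpace X] (f : X → EReal) (g : X → ℝ≥0∞)
    (γ : NontrivialTestCurve X) : Prop :=
  extDist (f (γ.toFun 1)) (f (γ.toFun 0)) ≤ γ.symIntegral g

/-- `g` is an upper S-gradient of `f`. -/
def IsUpperSGradient {X : Type*} [MetricSpace X] (f : X → EReal) (g : X → ℝ≥0∞) : Prop :=
  Measurable[borel X] g ∧ ∀ γ : NontrivialTestCurve X, UpperInequality f g γ

/-- `g` is a `p`-weak upper S-gradient of `f`: the inequality holds for all nontrivial test
curves outside a family of `p`-modulus zero. -/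
def IsWeakUpperSGradient {X : Type*} [MetricSpace X] [MeasurableSpace X] (μ : Measure X) (p : ℝ)
    (f : X → EReal) (g : X → ℝ≥0∞) : Prop :=
  Measurable[borel X] g ∧ pModulus μ p {γ | ¬ UpperInequality f g γ} = 0

/-- `g` is a Hajłasz gradient of `f` (for `f` measurable and finite a.e.). -/
def IsHajlaszGradient {X : Type*} [MetricSpace X] [MeasurableSpace X] (μ : Measure X)
    (f : X → EReal) (g : X → ℝ≥0∞) : Prop :=
  Measurable g ∧ ∃ E : Set X, MeasurableSet E ∧ μ E = 0 ∧
    ∀ x ∉ E, ∀ y ∉ E, extDist (f y) (f x) ≤ (g x + g y) * ENNReal.ofReal (dist x y)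

/-- `μ` is Borel regular: each measurable set lies in a Borel set of the same measure. -/
def IsBorelRegular {X : Type*} [MetricSpace X] [MeasurableSpace X] (μ : Measure X) : Prop :=
  ∀ A : Set X, MeasurableSet A → ∃ B : Set X, MeasurableSet[borel X] B ∧ A ⊆ B ∧ μ B = μ A

/-! ### Lower bounds for curve integrals near the endpoints -/

section CurveIntegral

variable {X : Type*} [MetricSpace X] {γ : ℝ → X} {a b : ℝ}

namespace IsTestCurve

/-! Part (a) tests the inequality on curves with one jump. Along the jump from `x` to `y` the
measure `μ_γ` lives where the curve equals `y`, and for the reversal where it equals `x`, so the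
symmetrized integral is at most the Hajłasz bound for `g / 2`. A family of modulus zero contains no
jump between points outside a suitable null set (`exists_null_of_pModulus_eq_zero`).

For part (b), Borel regularity gives a Borel `G`, set to `∞` on a null set, for which the Hajłasz
inequality holds at every pair of points. A curve may still end where `G = ∞`, so `f` is replaced by
the limit of its envelopes, the infima of `f + 2 r G` over balls of radius `r`. The envelope at `x`
differs from `f w` by at most `2 r G(w)` for every `w` in the ball (`edist_envelope_le`). Hence
envelopes at radii `r` and `r / 2`, or at two points within `2 r`, differ by a multiple of `r` times
infima of `G` over balls. For a curve that starts at distance at least `R` from its endpoint, the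
sum of these errors over dyadic radii up to `R` is controlled by the integral of `G`, because the
curve has length at least `r` inside each ball of radius `r ≤ R` around its endpoint
(`tsum_ballInf_le_testCurveIntegral`). The reversal handles the starting point. Chaining from one
endpoint through the common scale to the other gives the factor 24. -/

theorem stieltjes_apply (h : IsTestCurve γ a b) (t : ℝ) :
    h.stieltjes t = variationFunction γ a b t := rfl

theorem dist_add_variationFunction_le (h : IsTestCurve γ a b) {t : ℝ} (ht : t ∈ Icc a b) :
    dist (γ t) (γ b) + h.stieltjes t ≤ h.stieltjes b := by
  have hfin : eVariationOn γ (Icc a b) ≠ ∞ := h.boundedVariation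
  have h1 : Icc a b ∩ Iic t = Icc a t := by
    ext s; simp only [mem_inter_iff, mem_Icc, mem_Iic]
    exact ⟨fun hs => ⟨hs.1.1, hs.2⟩, fun hs => ⟨⟨hs.1, hs.2.trans ht.2⟩, hs.2⟩⟩
  have h2 : Icc a b ∩ Iic b = Icc a b := inter_eq_left.2 fun s hs => hs.2
  have hadd := eVariationOn.Icc_add_Icc γ (s := univ) ht.1 ht.2 (mem_univ t)
  simp only [univ_inter] at hadd
  have hle : eVariationOn γ (Icc a t) ≠ ∞ := by
    refine ne_top_of_le_ne_top hfin (eVariationOn.mono γ (Icc_subset_Icc_right ht.2))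
  have hed := eVariationOn.edist_le γ (s := Icc t b) (x := t) (y := b)
    ⟨le_rfl, ht.2⟩ ⟨ht.2, le_rfl⟩
  rw [stieltjes_apply, stieltjes_apply, variationFunction, variationFunction, h1, h2,
    dist_edist, ← ENNReal.toReal_add (edist_ne_top _ _) hle]
  refine ENNReal.toReal_mono hfin ?_
  rw [← hadd, add_comm]
  gcongr

/-- The part of a test curve inside the ball of radius `r` around its endpoint has length at
least `r`, provided that the curve starts outside of this ball. -/
theorem exists_measurableSet_dist_lt (h : IsTestCurve γ a b) {r : ℝ} (hrD : r ≤ dist (γ a) (γ b)) :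
    ∃ T : Set ℝ, MeasurableSet T ∧ T ⊆ Icc a b ∧ (∀ t ∈ T, dist (γ t) (γ b) < r) ∧
      ENNReal.ofReal r ≤ h.stieltjes.measure T := by
  set S : Set ℝ := {t | t ∈ Icc a b ∧ r ≤ dist (γ t) (γ b)} with hS
  have haS : a ∈ S := ⟨⟨le_rfl, h.lt.le⟩, hrD⟩
  have hbdd : BddAbove S := ⟨b, fun t ht => ht.1.2⟩
  have hτ : sSup S ∈ Icc a b := ⟨le_csSup hbdd haS, csSup_le ⟨a, haS⟩ fun t ht => ht.1.2⟩
  have hgt : ∀ t ∈ Icc a b, sSup S < t → dist (γ t) (γ b) < r := fun t ht hlt => by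
    by_contra hcon
    exact absurd (le_csSup hbdd (show t ∈ S from ⟨ht, not_lt.1 hcon⟩)) (not_le.2 hlt)
  -- `sSup S` is the last exit time from the complement of the ball. If it is not attained, the
  -- curve is already inside the ball at that time, and a possible jump there must be counted: hence
  -- the closed interval and the left limit of the variation.
  by_cases hmem : sSup S ∈ S
  · refine ⟨Ioc (sSup S) b, measurableSet_Ioc, fun t ht => ⟨hτ.1.trans ht.1.le, ht.2⟩,
      fun t ht => hgt t ⟨hτ.1.trans ht.1.le, ht.2⟩ ht.1, ?_⟩
    rw [StieltjesFunction.measure_Ioc]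
    apply ENNReal.ofReal_le_ofReal
    have := h.dist_add_variationFunction_le hτ
    linarith [hmem.2]
  · refine ⟨Icc (sSup S) b, measurableSet_Icc, fun t ht => ⟨hτ.1.trans ht.1, ht.2⟩,
      fun t ht => ?_, ?_⟩
    · rcases ht.1.eq_or_lt with heq | hlt
      · by_contra hcon
        exact hmem ⟨hτ, heq ▸ not_lt.1 hcon⟩
      · exact hgt t ⟨hτ.1.trans ht.1, ht.2⟩ hlt
    · rw [StieltjesFunction.measure_Icc, h.stieltjes.mono.leftLim_eq_sSup]
      apply ENNReal.ofReal_le_ofReal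
      suffices sSup (h.stieltjes '' Iio (sSup S)) ≤ h.stieltjes b - r by linarith
      refine csSup_le (nonempty_Iio.image _) ?_
      rintro _ ⟨s, hs, rfl⟩
      obtain ⟨s', hs', hlt⟩ := exists_lt_of_lt_csSup ⟨a, haS⟩ hs
      have := h.dist_add_variationFunction_le hs'.1
      linarith [hs'.2, h.stieltjes.mono hlt.le]

end IsTestCurve

/-- The infimum of `G` over the open ball of radius `r` around `x`. -/
noncomputable def ballInf (G : X → ℝ≥0∞) (r : ℝ) (x : X) : ℝ≥0∞ :=
  ⨅ z : Metric.ball x r, G z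

theorem ballInf_le (G : X → ℝ≥0∞) {r : ℝ} {x z : X} (hz : dist z x < r) :
    ballInf G r x ≤ G z :=
  iInf_le (fun z : Metric.ball x r => G z) ⟨z, hz⟩

theorem ballInf_anti (G : X → ℝ≥0∞) (x : X) {r s : ℝ} (h : r ≤ s) :
    ballInf G s x ≤ ballInf G r x :=
  le_iInf fun z => ballInf_le G (lt_of_lt_of_le z.2 h)

/-- The infima of `G` over dyadic balls around the endpoint of a test curve, weighted by the
radii, are controlled by the integral of `G` along the curve. -/
theorem tsum_ballInf_le_testCurveIntegral (h : IsTestCurve γ a b) (G : X → ℝ≥0∞) {R : ℝ}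
    (hR : 0 < R) (hRD : R ≤ dist (γ a) (γ b)) :
    ∑' k : ℕ, ballInf G (R / 2 ^ k) (γ b) * ENNReal.ofReal (R / 2 ^ (k + 1)) ≤
      testCurveIntegral h G := by
  set m : ℕ → ℝ≥0∞ := fun k => ballInf G (R / 2 ^ k) (γ b) with hm
  set r : ℕ → ℝ≥0∞ := fun k => ENNReal.ofReal (R / 2 ^ k) with hr
  have hhalf : ∀ k, r k = r (k + 1) + r (k + 1) := fun k => by
    rw [hr]; dsimp only
    rw [← ENNReal.ofReal_add (by positivity) (by positivity)]
    congr 1; rw [pow_succ]; field_simp; norm_num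
  have hmono : ∀ k, m k ≤ m (k + 1) := fun k => by
    apply ballInf_anti
    gcongr <;> norm_num
  have hleD : ∀ k : ℕ, R / 2 ^ k ≤ dist (γ a) (γ b) := fun k =>
    (div_le_self hR.le (one_le_pow₀ (by norm_num))).trans hRD
  choose T hTm hTs hTd hTμ using fun k => h.exists_measurableSet_dist_lt (hleD k)
  -- Increments of the nondecreasing sequence `m`; monotonicity makes truncated subtraction
  -- harmless, even at `∞`.
  let e : ℕ → ℝ≥0∞ := fun k => Nat.casesOn k (m 0) fun j => m (j + 1) - m j
  have he : ∀ n, ∑ j ∈ Finset.range (n + 1), e j = m n := fun n => by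
    induction n with
    | zero => simp [e]
    | succ n ih => rw [Finset.sum_range_succ, ih]; exact add_tsub_cancel_of_le (hmono n)
  -- Summation by parts, using `r k - r (k + 1) = r (k + 1)`.
  have habel : ∀ n, ∑ k ∈ Finset.range n, m k * r (k + 1) + m n * r n =
      ∑ j ∈ Finset.range (n + 1), e j * r j := fun n => by
    induction n with
    | zero => simp [e]
    | succ n ih =>
      rw [Finset.sum_range_succ _ (n + 1), ← ih, Finset.sum_range_succ, hhalf n,
        show m (n + 1) = m n + e (n + 1) from (add_tsub_cancel_of_le (hmono n)).symm]
      ring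
  -- The sets `T j` need not be nested: only the largest index `j` with `t ∈ T j` matters, as the
  -- increments up to it sum to at most `m j ≤ G (γ t)`.
  have hpt : ∀ t n, ∑ j ∈ Finset.range n, (T j).indicator (fun _ => e j) t ≤ G (γ t) :=
      fun t n => by
    induction n with
    | zero => simp
    | succ n ih =>
      by_cases ht : t ∈ T n
      · calc _ ≤ ∑ j ∈ Finset.range (n + 1), e j :=
              by
              refine Finset.sum_le_sum fun j _ => ?_
              by_cases hj : t ∈ T j <;> simp [hj]
          _ = m n := he n
          _ ≤ G (γ t) := ballInf_le G (hTd n t ht)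
      · rw [Finset.sum_range_succ, indicator_of_notMem ht, add_zero]
        exact ih
  refine ENNReal.tsum_le_of_sum_range_le fun n => ?_
  calc ∑ k ∈ Finset.range n, m k * r (k + 1)
      ≤ ∑ k ∈ Finset.range n, m k * r (k + 1) + m n * r n := le_self_add
    _ = ∑ j ∈ Finset.range (n + 1), e j * r j := habel n
    _ ≤ ∑ j ∈ Finset.range (n + 1), e j * h.stieltjes.measure (T j) := by
        gcongr with j; exact hTμ j
    _ = ∫⁻ t in Icc a b, ∑ j ∈ Finset.range (n + 1), (T j).indicator (fun _ => e j) t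
          ∂h.stieltjes.measure := by
        rw [lintegral_finsetSum _ fun j _ => measurable_const.indicator (hTm j)]
        refine Finset.sum_congr rfl fun j _ => ?_
        rw [lintegral_indicator_const (hTm j), Measure.restrict_apply (hTm j),
          inter_eq_left.2 (hTs j)]
    _ ≤ testCurveIntegral h G := lintegral_mono fun t => hpt t _

end CurveIntegral

/-! ### The regularization of a function with a Hajłasz gradient -/

section Regularization

variable {X : Type*} [MetricSpace X]

/-- The infimum of `f + 2 r G` over the open ball of radius `r` around `x`. -/
noncomputable def envelope (f : X → ℝ) (G : X → ℝ≥0∞) (r : ℝ) (x : X) : EReal :=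
  ⨅ z : {z // G z ≠ ∞ ∧ dist z x < r}, ((f z + 2 * r * (G z).toReal : ℝ) : EReal)

/-- Sublevel sets are unions of open balls around admissible `z`, so no measurability of `f` or `G`
is needed. -/
theorem measurable_envelope [MeasurableSpace X] [BorelSpace X] (f : X → ℝ) (G : X → ℝ≥0∞)
    (r : ℝ) : Measurable (envelope f G r) := by
  refine measurable_of_Iio fun c => IsOpen.measurableSet ?_
  have : envelope f G r ⁻¹' Iio c =
      ⋃ z ∈ {z | G z ≠ ∞ ∧ ((f z + 2 * r * (G z).toReal : ℝ) : EReal) < c}, Metric.ball z r := by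
    ext x
    simp only [mem_preimage, mem_Iio, envelope, iInf_lt_iff, Subtype.exists, mem_iUnion,
      mem_ofPred_eq, Metric.mem_ball, dist_comm x, exists_prop]
    exact exists_congr fun z => by tauto
  rw [this]
  exact isOpen_biUnion fun z _ => Metric.isOpen_ball

/-- The limit of `envelope f G r` for `r → 0` along powers of `2`. -/
noncomputable def regularization (f : X → ℝ) (G : X → ℝ≥0∞) (x : X) : ℝ :=
  (limsup (fun k : ℕ => ((envelope f G (1 / 2 ^ k) x).toReal : EReal)) atTop).toReal

theorem measurable_regularization [MeasurableSpace X] [BorelSpace X] (f : X → ℝ)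
    (G : X → ℝ≥0∞) : Measurable (regularization f G) :=
  (Measurable.limsup fun _ => (measurable_envelope f G _).ereal_toReal.coe_real_ereal).ereal_toReal

theorem regularization_eq_of_tendsto {f : X → ℝ} {G : X → ℝ≥0∞} {x : X} {L : ℝ}
    (h : Tendsto (fun k : ℕ => (envelope f G (1 / 2 ^ k) x).toReal) atTop (𝓝 L)) :
    regularization f G x = L := by
  have h1 : Tendsto (fun k : ℕ => ((envelope f G (1 / 2 ^ k) x).toReal : EReal)) atTop
      (𝓝 (L : EReal)) := (continuous_coe_real_ereal.tendsto L).comp h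
  rw [regularization, h1.limsup_eq, EReal.toReal_coe]

/-- The two dyadic sequences of radii are shifts of each other, so chaining may start at the scale
of the given curve. -/
theorem regularization_eq_of_tendsto_zpow {f : X → ℝ} {G : X → ℝ≥0∞} {x : X} {L : ℝ} (n : ℤ)
    (h : Tendsto (fun k : ℕ => (envelope f G (2 ^ n / 2 ^ k) x).toReal) atTop (𝓝 L)) :
    regularization f G x = L := by
  apply regularization_eq_of_tendsto
  obtain ⟨m, rfl | rfl⟩ := n.eq_nat_or_neg
  · refine (h.comp (tendsto_add_atTop_nat m)).congr fun k => ?_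
    simp only [Function.comp_apply, zpow_natCast, pow_add]
    congr 2
    field_simp
  · refine (tendsto_add_atTop_iff_nat m).1 (h.congr fun k => ?_)
    rw [zpow_neg, zpow_natCast, pow_add]
    congr 2
    field_simp

variable {f : X → ℝ} {G : X → ℝ≥0∞}

/-- Testing the infimum with `w` gives the upper bound. For the lower bound, points of the ball are
at distance at most `2 r`, and the penalty `2 r G(z)` absorbs the contribution of `G z` to the
Hajłasz inequality. -/
theorem edist_envelope_le (hfG : ∀ x y, edist (f x) (f y) ≤ (G x + G y) * edist x y) {r : ℝ}
    {x w : X} (hw : dist w x < r) :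
    edist (envelope f G r x).toReal (f w) ≤ ENNReal.ofReal (2 * r) * G w := by
  have hr : 0 < r := dist_nonneg.trans_lt hw
  by_cases hGw : G w = ∞
  · rw [hGw, ENNReal.mul_top (by simpa using hr)]
    exact le_top
  have hreal : ∀ z, G z ≠ ∞ → |f w - f z| ≤ ((G w).toReal + (G z).toReal) * dist w z :=
      fun z hz => by
    have := ENNReal.toReal_mono
      (ENNReal.mul_ne_top (ENNReal.add_ne_top.2 ⟨hGw, hz⟩) (edist_ne_top w z)) (hfG w z)
    rwa [ENNReal.toReal_mul, ENNReal.toReal_add hGw hz, ← dist_edist, ← dist_edist,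
      Real.dist_eq] at this
  have hup : envelope f G r x ≤ ((f w + 2 * r * (G w).toReal : ℝ) : EReal) :=
    iInf_le (fun z : {z // G z ≠ ∞ ∧ dist z x < r} =>
      ((f z + 2 * r * (G z).toReal : ℝ) : EReal)) ⟨w, hGw, hw⟩
  have hlow : ((f w - 2 * r * (G w).toReal : ℝ) : EReal) ≤ envelope f G r x := by
    refine le_iInf fun ⟨z, hz, hzx⟩ => EReal.coe_le_coe_iff.2 ?_
    have h1 := (abs_le.1 (hreal z hz)).2
    have h2 : dist w z ≤ 2 * r := by linarith [dist_triangle_right w z x]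
    have h3 : 0 ≤ (G w).toReal + (G z).toReal := by positivity
    nlinarith [mul_le_mul_of_nonneg_left h2 h3]
  lift envelope f G r x to ℝ using ⟨ne_top_of_le_ne_top (EReal.coe_ne_top _) hup,
    ne_bot_of_le_ne_bot (EReal.coe_ne_bot _) hlow⟩ with c
  rw [EReal.coe_le_coe_iff] at hup hlow
  rw [EReal.toReal_coe, edist_dist, Real.dist_eq, ← ENNReal.ofReal_toReal hGw,
    ← ENNReal.ofReal_mul (by positivity)]
  exact ENNReal.ofReal_le_ofReal (abs_le.2 ⟨by linarith, by linarith⟩)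

theorem regularization_eq (hfG : ∀ x y, edist (f x) (f y) ≤ (G x + G y) * edist x y) {x : X}
    (hx : G x ≠ ∞) : regularization f G x = f x := by
  apply regularization_eq_of_tendsto
  rw [tendsto_iff_edist_tendsto_0]
  have h1 : Tendsto (fun k : ℕ => ENNReal.ofReal (2 * (1 / 2 ^ k)) * G x) atTop (𝓝 0) := by
    have h2 : Tendsto (fun k : ℕ => 2 * (1 / 2 ^ k : ℝ)) atTop (𝓝 0) := by
      simpa [one_div] using (tendsto_pow_atTop_nhds_zero_of_lt_one (r := (2⁻¹ : ℝ))
        (by norm_num) (by norm_num)).const_mul 2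
    simpa using ENNReal.Tendsto.mul_const (ENNReal.tendsto_ofReal h2) (Or.inr hx)
  exact tendsto_of_tendsto_of_tendsto_of_le_of_le tendsto_const_nhds h1 (fun _ => zero_le)
    fun k => edist_envelope_le hfG (by rw [dist_self]; positivity)

/-- Both envelopes are compared with `f w` for `w` in the smaller ball: `2 r + r = 3 r`. -/
theorem edist_envelope_half_le (hfG : ∀ x y, edist (f x) (f y) ≤ (G x + G y) * edist x y)
    {r : ℝ} (hr : 0 < r) (x : X) :
    edist (envelope f G r x).toReal (envelope f G (r / 2) x).toReal ≤
      ENNReal.ofReal (3 * r) * ballInf G (r / 2) x := by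
  rw [ballInf, ENNReal.mul_iInf_of_ne (by simpa using hr) ENNReal.ofReal_ne_top]
  refine le_iInf fun ⟨w, hw⟩ => ?_
  have hw' : dist w x < r / 2 := hw
  refine (edist_triangle_right _ _ (f w)).trans ((add_le_add
    (edist_envelope_le hfG (hw'.trans (by linarith))) (edist_envelope_le hfG hw')).trans_eq ?_)
  rw [← add_mul, ← ENNReal.ofReal_add (by positivity) (by positivity)]
  congr 2
  ring

/-- Points `z`, `w` of the two balls are at distance at most `4 r`, so each value of `G` enters with
factor `2 r + 4 r`. -/
theorem edist_envelope_envelope_le (hfG : ∀ x y, edist (f x) (f y) ≤ (G x + G y) * edist x y)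
    {r : ℝ} (hr : 0 < r) {x y : X} (hxy : dist x y ≤ 2 * r) :
    edist (envelope f G r x).toReal (envelope f G r y).toReal ≤
      ENNReal.ofReal (6 * r) * ballInf G r x + ENNReal.ofReal (6 * r) * ballInf G r y := by
  have hc : ENNReal.ofReal (6 * r) ≠ 0 := by simpa using hr
  rw [ballInf, ballInf, ENNReal.mul_iInf_of_ne hc ENNReal.ofReal_ne_top,
    ENNReal.mul_iInf_of_ne hc ENNReal.ofReal_ne_top]
  simp_rw [ENNReal.iInf_add, ENNReal.add_iInf]
  refine le_iInf fun ⟨z, hz⟩ => le_iInf fun ⟨w, hw⟩ => ?_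
  rw [Metric.mem_ball] at hz hw
  have hzw : edist z w ≤ ENNReal.ofReal (4 * r) := by
    rw [edist_dist]
    apply ENNReal.ofReal_le_ofReal
    have := dist_triangle4_right z w x y
    linarith
  calc _ ≤ edist (envelope f G r x).toReal (f z) + edist (f z) (f w) +
        edist (f w) (envelope f G r y).toReal := edist_triangle4 _ _ _ _
    _ ≤ ENNReal.ofReal (2 * r) * G z + (G z + G w) * ENNReal.ofReal (4 * r) +
        ENNReal.ofReal (2 * r) * G w := by
      refine add_le_add (add_le_add (edist_envelope_le hfG hz) ((hfG z w).trans ?_)) ?_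
      · gcongr
      · rw [edist_comm]
        exact edist_envelope_le hfG hw
    _ = _ := by
      rw [show 6 * r = 2 * r + 4 * r by ring, ENNReal.ofReal_add (by positivity) (by positivity)]
      ring

/-- Telescoping over the scales uses only the terms of index at least 1. The unused term of index 0
pays for the share of this endpoint in the comparison of the two endpoints. -/
theorem edist_envelope_regularization_le
    (hfG : ∀ x y, edist (f x) (f y) ≤ (G x + G y) * edist x y) (n : ℤ) (x : X)
    (hfin : ∑' k : ℕ, ballInf G (2 ^ n / 2 ^ k) x * ENNReal.ofReal (2 ^ n / 2 ^ (k + 1)) ≠ ∞) :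
    edist (envelope f G (2 ^ n) x).toReal (regularization f G x) +
        ENNReal.ofReal (6 * 2 ^ n) * ballInf G (2 ^ n) x ≤
      12 * ∑' k : ℕ, ballInf G (2 ^ n / 2 ^ k) x * ENNReal.ofReal (2 ^ n / 2 ^ (k + 1)) := by
  set s : ℕ → ℝ≥0∞ := fun k => ballInf G (2 ^ n / 2 ^ k) x * ENNReal.ofReal (2 ^ n / 2 ^ (k + 1))
  have hs : ∑' k, s k = s 0 + ∑' k, s (k + 1) := tsum_eq_zero_add' ENNReal.summable
  have hstep : ∀ k : ℕ, edist (envelope f G (2 ^ n / 2 ^ k) x).toReal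
      (envelope f G (2 ^ n / 2 ^ (k + 1)) x).toReal ≤ 12 * s (k + 1) := fun k => by
    have h1 := edist_envelope_half_le hfG (r := 2 ^ n / 2 ^ k) (by positivity) x
    have h2 : (2 : ℝ) ^ n / 2 ^ k / 2 = 2 ^ n / 2 ^ (k + 1) := by rw [pow_succ]; field_simp
    rw [h2] at h1
    refine h1.trans_eq ?_
    have h3 : 3 * ((2 : ℝ) ^ n / 2 ^ k) = 12 * (2 ^ n / 2 ^ (k + 1 + 1)) := by
      rw [pow_succ, pow_succ]; field_simp; norm_num
    rw [h3, ENNReal.ofReal_mul (by norm_num), ENNReal.ofReal_ofNat]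
    ring
  have hfin' : ∑' k, 12 * s (k + 1) ≠ ∞ := by
    rw [ENNReal.tsum_mul_left]
    refine ENNReal.mul_ne_top (by simp) (ne_top_of_le_ne_top hfin ?_)
    exact hs ▸ le_add_self
  obtain ⟨L, hL⟩ := cauchySeq_tendsto_of_complete
    (cauchySeq_of_edist_le_of_tsum_ne_top _ hstep hfin')
  have hle := edist_le_tsum_of_edist_le_of_tendsto₀ _ hstep hL
  rw [pow_zero, div_one, ENNReal.tsum_mul_left] at hle
  rw [regularization_eq_of_tendsto_zpow n hL, hs, mul_add, add_comm]
  refine add_le_add (le_of_eq ?_) hle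
  have h3 : 6 * (2 : ℝ) ^ n = 12 * (2 ^ n / 2 ^ (0 + 1)) := by ring
  rw [h3, ENNReal.ofReal_mul (by norm_num), ENNReal.ofReal_ofNat]
  simp only [s, pow_zero, div_one]
  ring

theorem edist_regularization_le_testCurveIntegral {γ : ℝ → X} {a b : ℝ}
    (hfG : ∀ x y, edist (f x) (f y) ≤ (G x + G y) * edist x y) (h : IsTestCurve γ a b) :
    edist (regularization f G (γ b)) (regularization f G (γ a)) ≤
      12 * (testCurveIntegral h G + testCurveIntegral h.reverse G) := by
  rcases eq_or_ne (γ a) (γ b) with heq | hne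
  · rw [heq, edist_self]
    exact zero_le
  -- The scale satisfies `2 ^ n ≤ d < 2 * 2 ^ n`: the left bound lets the curve leave the balls, the
  -- right one allows the comparison of endpoints.
  obtain ⟨n, hn1, hn2⟩ := exists_mem_Ico_zpow (dist_pos.2 hne) (one_lt_two (α := ℝ))
  rw [zpow_add_one₀ two_ne_zero, mul_comm] at hn2
  have hra : reversal γ a b a = γ b := by
    rw [reversal, if_pos h.lt, add_sub_cancel_left]
    exact leftLim_eq_of_tendsto (h.leftContinuous.tendsto.mono_left
      (nhdsWithin_mono _ Iio_subset_Iic_self))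
  have hrb : reversal γ a b b = γ a := if_neg (lt_irrefl b)
  have hb := tsum_ballInf_le_testCurveIntegral h G (zpow_pos two_pos n) hn1
  have ha := tsum_ballInf_le_testCurveIntegral h.reverse G (R := 2 ^ n) (zpow_pos two_pos n)
    (by rwa [hra, hrb, dist_comm])
  rw [hrb] at ha
  by_cases hfin : testCurveIntegral h G + testCurveIntegral h.reverse G = ∞
  · rw [hfin, ENNReal.mul_top (by simp)]
    exact le_top
  rw [ENNReal.add_eq_top, not_or] at hfin
  have h1 := edist_envelope_regularization_le hfG n (γ b) (ne_top_of_le_ne_top hfin.1 hb)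
  have h2 := edist_envelope_regularization_le hfG n (γ a) (ne_top_of_le_ne_top hfin.2 ha)
  have h3 := edist_envelope_envelope_le hfG (r := 2 ^ n) (zpow_pos two_pos n)
    ((dist_comm (γ b) (γ a)).trans_le hn2.le)
  set ua := (envelope f G (2 ^ n) (γ a)).toReal
  set ub := (envelope f G (2 ^ n) (γ b)).toReal
  calc _ ≤ edist (regularization f G (γ b)) ub + edist ub ua +
        edist ua (regularization f G (γ a)) := edist_triangle4 _ _ _ _
    _ ≤ edist (regularization f G (γ b)) ub + (ENNReal.ofReal (6 * 2 ^ n) * ballInf G (2 ^ n) (γ b)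
        + ENNReal.ofReal (6 * 2 ^ n) * ballInf G (2 ^ n) (γ a)) +
        edist ua (regularization f G (γ a)) := by gcongr
    _ = (edist ub (regularization f G (γ b)) + ENNReal.ofReal (6 * 2 ^ n) *
          ballInf G (2 ^ n) (γ b)) + (edist ua (regularization f G (γ a)) +
          ENNReal.ofReal (6 * 2 ^ n) * ballInf G (2 ^ n) (γ a)) := by
        rw [edist_comm _ ub]
        ring
    _ ≤ _ := by
        rw [mul_add]
        exact add_le_add (h1.trans (by gcongr)) (h2.trans (by gcongr))

/-- The threshold 24 is twice 12, because the symmetrized integral is an average. -/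
theorem isUpperSGradient_regularization (hG : Measurable[borel X] G)
    (hfG : ∀ x y, edist (f x) (f y) ≤ (G x + G y) * edist x y) {c : ℝ≥0∞} (hc : 24 ≤ c)
    (hc_top : c ≠ ∞) :
    IsUpperSGradient (fun x => (regularization f G x : EReal)) fun x => c * G x := by
  refine ⟨hG.const_mul c, fun γ => ?_⟩
  rw [UpperInequality, extDist_coe, ← Real.dist_eq, ← edist_dist]
  refine (edist_regularization_le_testCurveIntegral hfG γ.isTestCurve).trans ?_
  simp only [NontrivialTestCurve.symIntegral, symTestCurveIntegral, testCurveIntegral]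
  rw [lintegral_const_mul' _ _ hc_top, lintegral_const_mul' _ _ hc_top, ← mul_add,
    ENNReal.le_div_iff_mul_le (by simp) (by simp), mul_right_comm]
  gcongr
  exact le_trans (by norm_num) hc

end Regularization

/-! ### Curves with a single jump -/

section JumpCurve

variable {X : Type*}

/-- The curve that jumps from `x` to `y` at time `1 / 2`. -/
noncomputable def jumpCurve (x y : X) : ℝ → X := fun t => if t < 1 / 2 then x else y

theorem jumpCurve_of_lt (x y : X) {t : ℝ} (ht : t < 1 / 2) : jumpCurve x y t = x := if_pos ht

theorem jumpCurve_of_le (x y : X) {t : ℝ} (ht : 1 / 2 ≤ t) : jumpCurve x y t = y :=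
  if_neg (not_lt.2 ht)

theorem jumpCurve_eventuallyEq_nhdsLT (x y : X) {t : ℝ} (ht : t ≤ 1 / 2) :
    jumpCurve x y =ᶠ[𝓝[<] t] fun _ => x := by
  filter_upwards [self_mem_nhdsWithin] with s hs
  exact jumpCurve_of_lt x y (lt_of_lt_of_le hs ht)

theorem jumpCurve_eventuallyEq_nhds (x y : X) {t : ℝ} (ht : 1 / 2 < t) :
    jumpCurve x y =ᶠ[𝓝 t] fun _ => y := by
  filter_upwards [Ioi_mem_nhds ht] with s hs
  exact jumpCurve_of_le x y (le_of_lt hs)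

variable [MetricSpace X]

theorem eVariationOn_jumpCurve_le (x y : X) :
    eVariationOn (jumpCurve x y) (Icc 0 1) ≤ edist x y := by
  have hmono : Monotone (jumpCurve (0 : ℝ) 1) := fun s t hst => by
    rcases lt_or_ge t (1 / 2) with ht | ht
    · rw [jumpCurve_of_lt _ _ ht, jumpCurve_of_lt _ _ (hst.trans_lt ht)]
    · rw [jumpCurve_of_le _ _ ht]
      unfold jumpCurve
      split_ifs <;> norm_num
  have hmaps : MapsTo (jumpCurve (0 : ℝ) 1) (Icc 0 1) {0, 1} := fun t _ => by
    unfold jumpCurve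
    split_ifs <;> simp
  have hlip : LipschitzOnWith (nndist x y) (jumpCurve x y) {(0 : ℝ), 1} := by
    have h0 : jumpCurve x y 0 = x := jumpCurve_of_lt _ _ (by norm_num)
    have h1 : jumpCurve x y 1 = y := jumpCurve_of_le _ _ (by norm_num)
    refine LipschitzOnWith.of_dist_le_mul ?_
    rintro s (rfl | rfl) t (rfl | rfl) <;> simp [h0, h1, dist_comm]
  -- Factoring through the monotone 0-1 step, of variation 1, reduces the bound to a Lipschitz
  -- estimate on two points.
  have hcomp : jumpCurve x y = jumpCurve x y ∘ jumpCurve (0 : ℝ) 1 := by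
    funext t
    rcases lt_or_ge t (1 / 2) with ht | ht
    · rw [Function.comp_apply, jumpCurve_of_lt _ _ ht, jumpCurve_of_lt _ _ ht,
        jumpCurve_of_lt _ _ (by norm_num)]
    · rw [Function.comp_apply, jumpCurve_of_le _ _ ht, jumpCurve_of_le _ _ ht,
        jumpCurve_of_le _ _ (by norm_num)]
  have h1 := hlip.comp_eVariationOn_le hmaps
  have h2 := (hmono.monotoneOn (Icc 0 1)).eVariationOn_eq (a := 0) (b := 1) (by simp) (by simp)
  rw [jumpCurve_of_lt (t := 0) _ _ (by norm_num), jumpCurve_of_le (t := 1) _ _ (by norm_num),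
    inter_self, sub_zero, ENNReal.ofReal_one] at h2
  rw [hcomp]
  calc _ ≤ _ := h1
    _ = (nndist x y : ℝ≥0∞) * 1 := by rw [h2]
    _ = edist x y := by rw [mul_one, edist_nndist]

theorem isTestCurve_jumpCurve (x y : X) : IsTestCurve (jumpCurve x y) 0 1 where
  lt := zero_lt_one
  boundedVariation := ne_top_of_le_ne_top (edist_ne_top x y) (eVariationOn_jumpCurve_le x y)
  rightContinuous := fun t _ => by
    rcases lt_or_ge t (1 / 2) with h | h
    · refine (continuousWithinAt_const (b := x)).congr_of_eventuallyEq ?_ (jumpCurve_of_lt x y h)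
      filter_upwards [mem_nhdsWithin_of_mem_nhds (Iio_mem_nhds h)] with s hs
      exact jumpCurve_of_lt x y hs
    · exact continuousWithinAt_const.congr (fun s hs => jumpCurve_of_le x y (h.trans hs))
        (jumpCurve_of_le x y h)
  leftContinuous := (continuousWithinAt_const (b := y)).congr_of_eventuallyEq
    ((jumpCurve_eventuallyEq_nhds x y (t := 1) (by norm_num)).filter_mono nhdsWithin_le_nhds)
    (jumpCurve_of_le x y (t := 1) (by norm_num))
  leftLimits := fun t _ => by
    rcases lt_or_ge (1 / 2) t with h | h
    · exact ⟨y, tendsto_const_nhds.congr'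
        ((jumpCurve_eventuallyEq_nhds x y h).filter_mono nhdsWithin_le_nhds).symm⟩
    · exact ⟨x, tendsto_const_nhds.congr' (jumpCurve_eventuallyEq_nhdsLT x y h).symm⟩

theorem reversal_jumpCurve (x y : X) : EqOn (reversal (jumpCurve x y) 0 1) (jumpCurve y x)
    (Icc 0 1) := fun t ht => by
  unfold reversal
  split_ifs with h1
  · rcases lt_or_ge t (1 / 2) with h | h
    · rw [jumpCurve_of_lt _ _ h]
      exact leftLim_eq_of_tendsto (tendsto_const_nhds.congr'
        ((jumpCurve_eventuallyEq_nhds x y (by linarith)).filter_mono nhdsWithin_le_nhds).symm)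
    · rw [jumpCurve_of_le _ _ h]
      exact leftLim_eq_of_tendsto (tendsto_const_nhds.congr'
        (jumpCurve_eventuallyEq_nhdsLT x y (by linarith)).symm)
  · rw [jumpCurve_of_lt _ _ (by norm_num), jumpCurve_of_le _ _ (by linarith)]

/-- The variation vanishes before time `1 / 2`, so the measure charges only times at which the curve
equals `y`. Agreement on `[0, 1]` suffices, so that the reversal is covered as well. -/
theorem testCurveIntegral_le_of_eqOn_jumpCurve {γ : ℝ → X} (h : IsTestCurve γ 0 1) {x y : X}
    (hγ : EqOn γ (jumpCurve x y) (Icc 0 1)) (G : X → ℝ≥0∞) :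
    testCurveIntegral h G ≤ G y * edist x y := by
  have hzero : ∀ t < (1 / 2 : ℝ), h.stieltjes t = 0 := fun t ht => by
    change (eVariationOn γ _).toReal = 0
    rw [eVariationOn.constant_on, ENNReal.toReal_zero]
    refine subsingleton_singleton.anti (t := {x}) ?_
    rintro _ ⟨s, hs, rfl⟩
    rw [hγ hs.1, mem_singleton_iff]
    exact jumpCurve_of_lt _ _ (lt_of_le_of_lt hs.2 ht)
  have hll : ∀ t ≤ (1 / 2 : ℝ), Function.leftLim h.stieltjes t = 0 := fun t ht => by
    refine leftLim_eq_of_tendsto (tendsto_const_nhds.congr' ?_)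
    filter_upwards [self_mem_nhdsWithin] with s hs
    exact (hzero s (lt_of_lt_of_le hs ht)).symm
  have hnull : h.stieltjes.measure (Ico 0 (1 / 2)) = 0 := by
    rw [StieltjesFunction.measure_Ico, hll _ le_rfl, hll _ (by norm_num)]
    simp
  have htotal : h.stieltjes.measure (Icc 0 1) ≤ edist x y := by
    rw [StieltjesFunction.measure_Icc, hll _ (by norm_num), sub_zero]
    refine ENNReal.ofReal_toReal_le.trans ?_
    refine (eVariationOn.mono γ inter_subset_left).trans ?_
    rw [eVariationOn.congr hγ]
    exact eVariationOn_jumpCurve_le x y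
  calc testCurveIntegral h G ≤ ∫⁻ _ in Icc 0 1, G y ∂h.stieltjes.measure := by
        refine lintegral_mono_ae ?_
        have : ∀ᵐ t ∂h.stieltjes.measure, t ∉ Ico (0 : ℝ) (1 / 2) :=
          measure_eq_zero_iff_ae_notMem.1 hnull
        filter_upwards [ae_restrict_of_ae this, ae_restrict_mem measurableSet_Icc] with t h1 h2
        rw [hγ h2, jumpCurve_of_le]
        by_contra hlt
        exact h1 ⟨h2.1, not_le.1 hlt⟩
    _ ≤ G y * edist x y := by
        rw [lintegral_const, Measure.restrict_apply_univ]
        gcongr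

/-- The jump from `x` to `y ≠ x` as a nontrivial test curve. -/
noncomputable def jumpTestCurve {x y : X} (hxy : x ≠ y) : NontrivialTestCurve X where
  toFun := jumpCurve x y
  isTestCurve := isTestCurve_jumpCurve x y
  variation_pos := by
    refine (edist_pos.2 hxy).trans_le ?_
    have := eVariationOn.edist_le (jumpCurve x y) (s := Icc (0 : ℝ) 1) (x := 0) (y := 1)
      (by simp) (by simp)
    rwa [jumpCurve_of_lt _ _ (by norm_num), jumpCurve_of_le _ _ (by norm_num)] at this

theorem symIntegral_jumpTestCurve_le {x y : X} (hxy : x ≠ y) (G : X → ℝ≥0∞) :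
    (jumpTestCurve hxy).symIntegral G ≤ (G x / 2 + G y / 2) * edist x y := by
  have h1 := testCurveIntegral_le_of_eqOn_jumpCurve (isTestCurve_jumpCurve x y)
    (fun _ _ => rfl) G
  have h2 := testCurveIntegral_le_of_eqOn_jumpCurve (isTestCurve_jumpCurve x y).reverse
    (reversal_jumpCurve x y) G
  calc (jumpTestCurve hxy).symIntegral G ≤ (G y * edist x y + G x * edist y x) / 2 :=
        ENNReal.div_le_div_right (add_le_add h1 h2) 2
    _ = (G x / 2 + G y / 2) * edist x y := by
        rw [edist_comm y x]
        simp only [div_eq_mul_inv]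
        ring

theorem upperInequality_jumpTestCurve_le {x y : X} (hxy : x ≠ y) {f : X → EReal} {G : X → ℝ≥0∞}
    (h : UpperInequality f G (jumpTestCurve hxy)) :
    extDist (f y) (f x) ≤ (G x / 2 + G y / 2) * edist x y := by
  have h0 : (jumpTestCurve hxy).toFun 0 = x := jumpCurve_of_lt _ _ (by norm_num)
  have h1 : (jumpTestCurve hxy).toFun 1 = y := jumpCurve_of_le _ _ (by norm_num)
  unfold UpperInequality at h
  rw [h0, h1] at h
  exact h.trans (symIntegral_jumpTestCurve_le hxy G)

/-- A family of zero modulus is avoided by the jumps between the points of a set of full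
measure. -/
theorem exists_null_of_pModulus_eq_zero [MeasurableSpace X] [OpensMeasurableSpace X]
    {μ : Measure X} {p : ℝ} (hp : 0 < p) {Γ : Set (NontrivialTestCurve X)}
    (hΓ : pModulus μ p Γ = 0) :
    ∃ E : Set X, MeasurableSet E ∧ μ E = 0 ∧
      ∀ x ∉ E, ∀ y ∉ E, ∀ hxy : x ≠ y, jumpTestCurve hxy ∉ Γ := by
  have hex : ∀ n : ℕ, ∃ ρ : X → ℝ≥0∞, (Measurable[borel X] ρ ∧ ∀ γ ∈ Γ, 1 ≤ γ.symIntegral ρ) ∧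
      ∫⁻ x, ρ x ^ p ∂μ < 2⁻¹ ^ n := fun n => by
    have : pModulus μ p Γ < 2⁻¹ ^ n := by
      rw [hΓ]
      exact ENNReal.pow_pos (by simp) n
    simpa only [pModulus, iInf_lt_iff, exists_prop] using this
  choose ρ hρ hlt using hex
  have hmeas : ∀ n, Measurable fun x => ρ n x ^ p := fun n =>
    ((hρ n).1.mono OpensMeasurableSpace.borel_le le_rfl).pow_const p
  have hsum : Measurable fun x => ∑' n, ρ n x ^ p := Measurable.tsum hmeas
  have hfin : ∫⁻ x, ∑' n, ρ n x ^ p ∂μ ≠ ∞ := by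
    rw [lintegral_tsum fun n => (hmeas n).aemeasurable]
    refine ne_top_of_le_ne_top ?_ (ENNReal.tsum_le_tsum fun n => (hlt n).le)
    simp [ENNReal.tsum_geometric]
  -- Off this set `ρ n` tends to 0, so the integrals of `ρ n` along a jump between two such points
  -- cannot all be at least 1.
  refine ⟨{x | ∑' n, ρ n x ^ p = ∞}, hsum (measurableSet_singleton _), ?_, ?_⟩
  · simpa [ae_iff] using ae_lt_top hsum hfin
  · intro x hx y hy hxy hmem
    have hlim : ∀ z, ∑' n, ρ n z ^ p ≠ ∞ → Tendsto (fun n => ρ n z) atTop (𝓝 0) := fun z hz => by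
      have h1 := (ENNReal.tendsto_atTop_zero_of_tsum_ne_top hz).ennrpow_const (1 / p)
      rw [ENNReal.zero_rpow_of_pos (by positivity)] at h1
      refine h1.congr fun n => ?_
      rw [← ENNReal.rpow_mul, mul_one_div_cancel hp.ne', ENNReal.rpow_one]
    have h0 : Tendsto (fun n => (ρ n x / 2 + ρ n y / 2) * edist x y) atTop (𝓝 0) := by
      have := ENNReal.Tendsto.mul_const (b := edist x y)
        (((ENNReal.Tendsto.div_const (hlim x hx) (b := 2) (by simp)).add
          (ENNReal.Tendsto.div_const (hlim y hy) (b := 2) (by simp)))) (Or.inr (edist_ne_top x y))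
      simpa using this
    have h1 : (1 : ℝ≥0∞) ≤ 0 := ge_of_tendsto' h0 fun n =>
      ((hρ n).2 _ hmem).trans (symIntegral_jumpTestCurve_le hxy _)
    simp at h1

/-- Half of a weak upper S-gradient is a Hajłasz gradient. -/
theorem IsWeakUpperSGradient.isHajlaszGradient [MeasurableSpace X] [OpensMeasurableSpace X]
    {μ : Measure X} {p : ℝ} (hp : 0 < p) {f : X → EReal} {g : X → ℝ≥0∞} (hf : Measurable f)
    (hf_fin : ∀ᵐ x ∂μ, f x ≠ ⊥ ∧ f x ≠ ⊤) (h : IsWeakUpperSGradient μ p f g) :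
    IsHajlaszGradient μ f fun x => g x / 2 := by
  have hg : Measurable g := h.1.mono OpensMeasurableSpace.borel_le le_rfl
  obtain ⟨E, hE, hE0, hEΓ⟩ := exists_null_of_pModulus_eq_zero hp h.2
  -- Infinite values of `f` are discarded because under the convention for `∞ - ∞` the inequality
  -- fails there already for `x = y`.
  refine ⟨hg.div_const 2, E ∪ {x | ¬ (f x ≠ ⊥ ∧ f x ≠ ⊤)}, ?_, ?_, ?_⟩
  · refine hE.union (MeasurableSet.compl ?_)
    exact (hf (measurableSet_singleton _)).compl.inter (hf (measurableSet_singleton _)).compl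
  · exact measure_union_null hE0 (ae_iff.1 hf_fin)
  · intro x hx y hy
    simp only [mem_union, mem_ofPred_eq, not_or, not_not] at hx hy
    rcases eq_or_ne x y with rfl | hxy
    · lift f x to ℝ using ⟨hx.2.2, hx.2.1⟩ with c
      rw [extDist_coe]
      simp
    · rw [← edist_dist]
      exact upperInequality_jumpTestCurve_le hxy (not_not.1 (hEΓ x hx.1 y hy.1 hxy))

end JumpCurve

/-! ### Borel representatives -/

section BorelRegular

variable {X : Type*} [MetricSpace X] [MeasurableSpace X] {μ : Measure X}

theorem IsBorelRegular.exists_null_superset (h : IsBorelRegular μ) {A : Set X} (hA : μ A = 0) :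
    ∃ N : Set X, MeasurableSet[borel X] N ∧ A ⊆ N ∧ μ N = 0 := by
  obtain ⟨N, hN, hsub, hNμ⟩ := h _ (measurableSet_toMeasurable μ A)
  exact ⟨N, hN, (subset_toMeasurable μ A).trans hsub, by rw [hNμ, measure_toMeasurable, hA]⟩

variable [OpensMeasurableSpace X]

theorem IsBorelRegular.trim_eq_zero (h : IsBorelRegular μ) {A : Set X} (hA : μ A = 0) :
    μ.trim OpensMeasurableSpace.borel_le A = 0 := by
  obtain ⟨N, hN, hsub, hN0⟩ := h.exists_null_superset hA
  exact measure_mono_null hsub ((trim_measurableSet_eq _ hN).trans hN0)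

/-- A Borel hull of equal measure differs from the set by a null set only when the measure is
finite; hence the decomposition into pieces of finite measure. -/
theorem IsBorelRegular.nullMeasurableSet_trim [SigmaFinite μ] (h : IsBorelRegular μ) {A : Set X}
    (hA : MeasurableSet A) :
    @NullMeasurableSet X (borel X) A (μ.trim OpensMeasurableSpace.borel_le) := by
  have hpiece : ∀ n, @NullMeasurableSet X (borel X) (A ∩ spanningSets μ n)
      (μ.trim OpensMeasurableSpace.borel_le) := fun n => by
    have hAn : MeasurableSet (A ∩ spanningSets μ n) := hA.inter (measurableSet_spanningSets μ n)
    obtain ⟨B, hB, hsub, hBμ⟩ := h _ hAn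
    have hfin : μ (A ∩ spanningSets μ n) ≠ ∞ :=
      ((measure_mono inter_subset_right).trans_lt (measure_spanningSets_lt_top μ n)).ne
    have hdiff : μ (B \ (A ∩ spanningSets μ n)) = 0 := by
      rw [measure_sdiff hsub hAn.nullMeasurableSet hfin, hBμ, tsub_self]
    refine ⟨B, hB, Filter.EventuallyLE.antisymm (LE.le.eventuallyLE hsub) ?_⟩
    exact ae_le_set.2 (h.trim_eq_zero hdiff)
  have : A = ⋃ n, A ∩ spanningSets μ n := by
    rw [← inter_iUnion, iUnion_spanningSets, inter_univ]
  rw [this]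
  exact NullMeasurableSet.iUnion hpiece

theorem IsBorelRegular.exists_borel_representative [SigmaFinite μ] (h : IsBorelRegular μ)
    {β : Type*} [MeasurableSpace β] [MeasurableSpace.CountablyGenerated β] {f : X → β}
    (hf : Measurable f) : ∃ f' : X → β, Measurable[borel X] f' ∧ f' =ᵐ[μ] f := by
  have hnull : @NullMeasurable X β (borel X) _ f (μ.trim OpensMeasurableSpace.borel_le) :=
    fun s hs => h.nullMeasurableSet_trim (hf hs)
  obtain ⟨f', hf', hae⟩ := hnull.aemeasurable
  exact ⟨f', hf', (ae_eq_of_ae_eq_trim hae).symm⟩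

/-- A Hajłasz gradient has a Borel representative that satisfies the Hajłasz inequality
everywhere for a real-valued Borel representative of the function. -/
theorem IsHajlaszGradient.exists_borel_representative [SigmaFinite μ] (h : IsBorelRegular μ)
    {f : X → EReal} {g : X → ℝ≥0∞} (hf_fin : ∀ᵐ x ∂μ, f x ≠ ⊥ ∧ f x ≠ ⊤)
    (hfg : IsHajlaszGradient μ f g) :
    ∃ (f' : X → ℝ) (g' : X → ℝ≥0∞), Measurable[borel X] g' ∧
      (∀ᵐ x ∂μ, (f' x : EReal) = f x) ∧ (∀ᵐ x ∂μ, g' x = g x) ∧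
      ∀ x y, edist (f' x) (f' y) ≤ (g' x + g' y) * edist x y := by
  obtain ⟨hg, E, -, hE0, hE⟩ := hfg
  obtain ⟨g₁, hg₁, hgae⟩ := h.exists_borel_representative hg
  have hgood : ∀ᵐ x ∂μ, (f x ≠ ⊥ ∧ f x ≠ ⊤) ∧ g₁ x = g x ∧ x ∉ E :=
    hf_fin.and (hgae.and (measure_eq_zero_iff_ae_notMem.1 hE0))
  obtain ⟨N, hN, hsub, hN0⟩ := h.exists_null_superset (ae_iff.1 hgood)
  have hNgood : ∀ x ∉ N, (f x ≠ ⊥ ∧ f x ≠ ⊤) ∧ g₁ x = g x ∧ x ∉ E := fun x hx => by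
    by_contra hcon
    exact hx (hsub hcon)
  have hNae : ∀ᵐ x ∂μ, x ∉ N := measure_eq_zero_iff_ae_notMem.1 hN0
  classical
  -- The value `∞` on `N` makes the inequality trivial for distinct points one of which lies in `N`.
  -- The real-valued function is not claimed to be Borel; the regularization restores this.
  refine ⟨fun x => (f x).toReal, N.piecewise (fun _ => ∞) g₁,
    Measurable.piecewise hN measurable_const hg₁, ?_, ?_, fun x y => ?_⟩
  · filter_upwards [hf_fin] with x hx using EReal.coe_toReal hx.2 hx.1
  · filter_upwards [hNae] with x hx
    rw [piecewise_eq_of_notMem _ _ _ hx, (hNgood x hx).2.1]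
  · rcases eq_or_ne x y with rfl | hxy
    · simp
    by_cases hx : x ∈ N
    · rw [piecewise_eq_of_mem _ _ _ hx, top_add, ENNReal.top_mul (edist_pos.2 hxy).ne']
      exact le_top
    by_cases hy : y ∈ N
    · rw [piecewise_eq_of_mem _ _ _ hy, add_top, ENNReal.top_mul (edist_pos.2 hxy).ne']
      exact le_top
    obtain ⟨⟨hx1, hx2⟩, hx3, hx4⟩ := hNgood x hx
    obtain ⟨⟨hy1, hy2⟩, hy3, hy4⟩ := hNgood y hy
    rw [piecewise_eq_of_notMem _ _ _ hx, piecewise_eq_of_notMem _ _ _ hy, hx3, hy3]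
    have := hE x hx4 y hy4
    rw [← edist_dist, ← EReal.coe_toReal hx2 hx1, ← EReal.coe_toReal hy2 hy1, extDist_coe,
      ← Real.dist_eq, ← edist_dist, edist_comm] at this
    exact this

end BorelRegular

/-! ### The two implications combined -/

theorem mainTheorem2 {X : Type*} [MetricSpace X] [MeasurableSpace X] [OpensMeasurableSpace X]
    (μ : Measure X) (p : ℝ) (hp : 1 ≤ p) (f : X → EReal) (g : X → ℝ≥0∞)
    (hf : Measurable f) (hg : Measurable g)
    (hf_fin : ∀ᵐ x ∂μ, f x ≠ ⊥ ∧ f x ≠ ⊤) (hg_fin : ∀ᵐ x ∂μ, g x ≠ ∞) :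
    (IsWeakUpperSGradient μ p f g → IsHajlaszGradient μ f (fun x => g x / 2)) ∧
    (SigmaFinite μ → IsBorelRegular μ → IsHajlaszGradient μ f g →
      ∃ (f' : X → ℝ) (g' : X → ℝ≥0∞),
        Measurable[borel X] f' ∧ Measurable[borel X] g' ∧
        (∀ᵐ x ∂μ, (f' x : EReal) = f x) ∧ (∀ᵐ x ∂μ, g' x = g x) ∧
        IsUpperSGradient (fun x => (f' x : EReal)) (fun x => 76 * g' x)) := by
  refine ⟨IsWeakUpperSGradient.isHajlaszGradient (by linarith) hf hf_fin, fun _ hμ hfg => ?_⟩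
  obtain ⟨f₀, G, hG, hf₀, hGg, hineq⟩ := hfg.exists_borel_representative hμ hf_fin
  refine ⟨regularization f₀ G, G,
    @measurable_regularization X _ (borel X) (@BorelSpace.mk X _ (borel X) rfl) f₀ G, hG, ?_, hGg,
    isUpperSGradient_regularization hG hineq (by norm_num) (by simp)⟩
  -- Finiteness of `g` almost everywhere enters here: regularization is known to preserve the value
  -- only where `G` is finite.
  filter_upwards [hf₀, hGg, hg_fin] with x hx1 hx2 hx3
  rw [regularization_eq hineq (hx2 ▸ hx3), hx1]
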